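/- Let $n\ge 0$ be an integer. Call $\varrho:\mathbb R^n\to[0,\infty)$ a density if it is Lebesgue integrable with $\int\varrho=1$. For $\mu\in\mathbb R^n$ and a real $n\times n$ matrix $P$, let $\mathscr D_{\mu,P}$ be the set of densities with finite second moment, mean vector $\mu$ and covariance matrix $P$; let $W_2$ be the Wasserstein-2 distance, i.e. $W_2^2(\varrho_1,\varrho_2)$ is the infimum of $\int\|x-y\|_2^2\,d\sigma(x,y)$ over all probability measures $\sigma$ on $\mathbb R^n\times\mathbb R^n$ with finite second moments and marginals $\varrho_1(x)dx$, $\varrho_2(y)dy$. Square roots of positive semidefinite matrices are the positive semidefinite ones. Let $P_0\succ0$ and $P\succ0$ be real symmetric $n\times n$ matrices, $\mu_0,\mu\in\mathbb R^n$, and $\varrho_0\in\mathscr D_{\mu_0,P_0}$. Then $$\inf_{\xi\in\mathscr D_{\mu,P}}W_2^2(\xi,\varrho_0)=\|\mu-\mu_0\|_2^2+\operatorname{tr}\Bigl(P+P_0-2\bigl(P_0^{1/2}PP_0^{1/2}\bigr)^{1/2}\Bigr).$$ The infimum is attained by the push-forward of $\varrho_0$ under the affine map $x\mapsto Mx+m$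 with $$M=P^{1/2}\bigl(P^{1/2}P_0P^{1/2}\bigr)^{-1/2}P^{1/2},\qquad m=\mu-M\mu_0 .$$ That is, the density of this push-forward, $$\varrho(x)=\sqrt{\frac{\det P_0}{\det P}}\;\varrho_0\Bigl(P^{-1/2}\bigl(P^{1/2}P_0P^{1/2}\bigr)^{1/2}P^{-1/2}(x-\mu)+\mu_0\Bigr),$$ belongs to $\mathscr D_{\mu,P}$ and attains the infimum; it is the only minimizer, up to equality almost everywhere. In particular, if $\varrho_0$ is the Gaussian density $\mathcal N(\mu_0,P_0)$, then $\varrho=\mathcal N(\mu,P)$. -/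

import Mathlib

open MeasureTheory ProbabilityTheory
open scoped ENNReal Matrix MatrixOrder

/-- `ρ` is a probability density function on `ℝⁿ` (with respect to Lebesgue measure). -/
def IsPDF {n : ℕ} (ρ : EuclideanSpace ℝ (Fin n) → ℝ) : Prop :=
  (∀ x, 0 ≤ ρ x) ∧ Integrable ρ ∧ ∫ x, ρ x = 1

/-- `ρ` is a probability density function on `ℝⁿ` with finite second moment. -/
def IsPDF₂ {n : ℕ} (ρ : EuclideanSpace ℝ (Fin n) → ℝ) : Prop :=
  IsPDF ρ ∧ Integrable (fun x => ‖x‖ ^ 2 * ρ x)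

/-- The mean vector of a density. -/
noncomputable def pdfMean {n : ℕ} (ρ : EuclideanSpace ℝ (Fin n) → ℝ) :
    EuclideanSpace ℝ (Fin n) :=
  WithLp.toLp 2 (fun i => ∫ x, x i * ρ x)

/-- The covariance matrix of a density. -/
noncomputable def pdfCov {n : ℕ} (ρ : EuclideanSpace ℝ (Fin n) → ℝ) :
    Matrix (Fin n) (Fin n) ℝ :=
  Matrix.of fun i j => ∫ x, (x i - pdfMean ρ i) * (x j - pdfMean ρ j) * ρ x

/-- The set of densities with finite second moment, mean `μ` and covariance matrix `P`. -/
def pdfsWith {n : ℕ} (μ : EuclideanSpace ℝ (Fin n)) (P : Matrix (Fin n) (Fin n) ℝ) :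
    Set (EuclideanSpace ℝ (Fin n) → ℝ) :=
  {ρ | IsPDF₂ ρ ∧ pdfMean ρ = μ ∧ pdfCov ρ = P}

/-- The measure on `ℝⁿ` whose Lebesgue density is `ρ`. -/
noncomputable def pdfMeasure {n : ℕ} (ρ : EuclideanSpace ℝ (Fin n) → ℝ) :
    Measure (EuclideanSpace ℝ (Fin n)) :=
  volume.withDensity fun x => ENNReal.ofReal (ρ x)

/-- The couplings of `ν₁` and `ν₂`: probability measures on the product space with finite
second moments and marginals `ν₁`, `ν₂`. -/
def couplings {n : ℕ} (ν₁ ν₂ : Measure (EuclideanSpace ℝ (Fin n))) :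
    Set (Measure (EuclideanSpace ℝ (Fin n) × EuclideanSpace ℝ (Fin n))) :=
  {σ | IsProbabilityMeasure σ ∧
    ∫⁻ z, ENNReal.ofReal (‖z.1‖ ^ 2 + ‖z.2‖ ^ 2) ∂σ < ∞ ∧
    σ.map Prod.fst = ν₁ ∧ σ.map Prod.snd = ν₂}

/-- The Wasserstein-2 distance between two measures on `ℝⁿ`, with values in `[0, ∞]`
(`∞` when there is no coupling). -/
noncomputable def measureW₂ {n : ℕ} (ν₁ ν₂ : Measure (EuclideanSpace ℝ (Fin n))) : ℝ≥0∞ :=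
  (⨅ σ ∈ couplings ν₁ ν₂, ∫⁻ z, ENNReal.ofReal (‖z.1 - z.2‖ ^ 2) ∂σ) ^ (1 / 2 : ℝ)

/-- The Wasserstein-2 distance between two densities on `ℝⁿ`. -/
noncomputable def W₂ {n : ℕ} (ρ₁ ρ₂ : EuclideanSpace ℝ (Fin n) → ℝ) : ℝ≥0∞ :=
  measureW₂ (pdfMeasure ρ₁) (pdfMeasure ρ₂)

/-- The density of the Gaussian distribution `N(μ, P)` on `ℝⁿ`, for positive definite `P`. -/
noncomputable def gaussianDensity {n : ℕ} (μ : EuclideanSpace ℝ (Fin n))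
    (P : Matrix (Fin n) (Fin n) ℝ) : EuclideanSpace ℝ (Fin n) → ℝ :=
  fun x => (Real.sqrt ((2 * Real.pi) ^ n * P.det))⁻¹ *
    Real.exp (-(1 / 2) * inner ℝ (x - μ) (Matrix.toEuclideanCLM (𝕜 := ℝ) P⁻¹ (x - μ)))

/-- The infimum of the squared Wasserstein-2 distance to `ρ₀` over the densities with mean `μ`
and covariance matrix `P`. -/
noncomputable def infSqW₂ {n : ℕ} (μ : EuclideanSpace ℝ (Fin n)) (P : Matrix (Fin n) (Fin n) ℝ)
    (ρ₀ : EuclideanSpace ℝ (Fin n) → ℝ) : ℝ≥0∞ :=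
  ⨅ ξ ∈ pdfsWith μ P, W₂ ξ ρ₀ ^ 2

/-! Let M be the matrix of the statement and T y = M (y - μ₀) + μ. For every coupling the cost
splits by completing a square: with a = x - μ, b = y - μ₀, d = μ - μ₀, the form ⟨x - T y, M⁻¹(x - T
y)⟩ equals ⟨a, M⁻¹a⟩ + ⟨b, M b⟩ - 2⟨a, b⟩, and its cross term is that of ‖x - y‖² = ‖a - b + d‖².
All other terms depend on x or y alone and are at most quadratic, so their integrals are fixed by
the means and covariances. Hence cost = constant + ∫ defect, where the defect is this nonnegative
form (`integral_transportDefect`). The constant takes the stated form because M P₀ M = P makes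
tr(M⁻¹P) and tr(M P₀) both equal to tr (P₀^{1/2} P P₀^{1/2})^{1/2}.

The lower bound follows at once, and the graph of T has zero defect, so it is attained.

Uniqueness needs no optimal coupling: if the infimum over couplings equals the constant, there are
couplings with arbitrarily small defect. Since M⁻¹ is positive definite, x is then close to T y in
L¹, so the characteristic functions of the competitor and of the push-forward agree
(`eq_map_transportMap`). -/

/-! ### Matrix identities for the transport matrix and its inverse. -/

section Matrix

variable {ι : Type*} [Fintype ι] [DecidableEq ι]

lemma Matrix.PosDef.sqrt {A : Matrix ι ι ℝ} (hA : A.PosDef) : (CFC.sqrt A).PosDef := by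
  rw [(Matrix.nonneg_iff_posSemidef.1 (CFC.sqrt_nonneg A)).posDef_iff_det_ne_zero]
  intro h
  have := congrArg Matrix.det (CFC.sqrt_mul_sqrt_self A hA.posSemidef.nonneg)
  rw [Matrix.det_mul, h] at this
  exact hA.det_pos.ne (by simpa using this)

/-- The linear part of the optimal transport map between laws of covariance `A` and `B`. -/
noncomputable def transportMatrix (A B : Matrix ι ι ℝ) : Matrix ι ι ℝ :=
  CFC.sqrt B * (CFC.sqrt (CFC.sqrt B * A * CFC.sqrt B))⁻¹ * CFC.sqrt B

/-- The inverse of `transportMatrix A B`. -/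
noncomputable def transportMatrixInv (A B : Matrix ι ι ℝ) : Matrix ι ι ℝ :=
  (CFC.sqrt B)⁻¹ * CFC.sqrt (CFC.sqrt B * A * CFC.sqrt B) * (CFC.sqrt B)⁻¹

lemma Matrix.PosDef.conj_posDef {A S : Matrix ι ι ℝ} (hA : A.PosDef) (hS : S.PosDef) :
    (S * A * S).PosDef := by
  have h := hA.conjTranspose_mul_mul_same (B := S)
    (Matrix.mulVec_injective_iff_isUnit.mpr hS.isUnit)
  rwa [hS.isHermitian.eq] at h

variable {A B : Matrix ι ι ℝ}

lemma posDef_transportMatrix (hA : A.PosDef) (hB : B.PosDef) : (transportMatrix A B).PosDef :=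
  (hA.conj_posDef hB.sqrt).sqrt.inv.conj_posDef hB.sqrt

lemma posDef_transportMatrixInv (hA : A.PosDef) (hB : B.PosDef) :
    (transportMatrixInv A B).PosDef :=
  (hA.conj_posDef hB.sqrt).sqrt.conj_posDef hB.sqrt.inv

lemma transportMatrix_mul_inv (hA : A.PosDef) (hB : B.PosDef) :
    transportMatrix A B * transportMatrixInv A B = 1 := by
  have h1 : IsUnit (CFC.sqrt B).det := hB.sqrt.isUnit.map Matrix.detMonoidHom
  have h2 : IsUnit (CFC.sqrt (CFC.sqrt B * A * CFC.sqrt B)).det :=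
    (hA.conj_posDef hB.sqrt).sqrt.isUnit.map Matrix.detMonoidHom
  unfold transportMatrix transportMatrixInv
  generalize CFC.sqrt (CFC.sqrt B * A * CFC.sqrt B) = R at h2 ⊢
  simp only [Matrix.mul_assoc]
  rw [Matrix.mul_nonsing_inv_cancel_left _ _ h1, Matrix.nonsing_inv_mul_cancel_left _ _ h2,
    Matrix.mul_nonsing_inv _ h1]

lemma transportMatrixInv_mul (hA : A.PosDef) (hB : B.PosDef) :
    transportMatrixInv A B * transportMatrix A B = 1 :=
  mul_eq_one_comm.mp (transportMatrix_mul_inv hA hB)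

/-- With S = B^{1/2} and R² = S A S, the middle of the product collapses: S R⁻¹ R² R⁻¹ S = S². This
is what makes the map carry covariance A to covariance B. -/
lemma transportMatrix_mul_mul (hA : A.PosDef) (hB : B.PosDef) :
    transportMatrix A B * A * transportMatrix A B = B := by
  have h2 : IsUnit (CFC.sqrt (CFC.sqrt B * A * CFC.sqrt B)).det :=
    (hA.conj_posDef hB.sqrt).sqrt.isUnit.map Matrix.detMonoidHom
  have h3 := CFC.sqrt_mul_sqrt_self _ (hA.conj_posDef hB.sqrt).posSemidef.nonneg
  have h4 := CFC.sqrt_mul_sqrt_self _ hB.posSemidef.nonneg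
  unfold transportMatrix
  set S := CFC.sqrt B
  set R := CFC.sqrt (S * A * S)
  calc S * R⁻¹ * S * A * (S * R⁻¹ * S) = S * R⁻¹ * (S * A * S) * R⁻¹ * S := by
        simp only [Matrix.mul_assoc]
    _ = S * (R⁻¹ * R) * (R * R⁻¹) * S := by rw [← h3]; simp only [Matrix.mul_assoc]
    _ = B := by rw [Matrix.nonsing_inv_mul _ h2, Matrix.mul_nonsing_inv _ h2]; simpa using h4

/-- The right side is positive semidefinite and its square is A^{1/2} (M A M) A^{1/2} = A^{1/2} B
A^{1/2}; square roots are unique. This links the root built from A^{1/2} in the cost to the one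
built from B^{1/2} in the map. -/
lemma sqrt_conj_eq (hA : A.PosDef) (hB : B.PosDef) :
    CFC.sqrt (CFC.sqrt A * B * CFC.sqrt A) = CFC.sqrt A * transportMatrix A B * CFC.sqrt A := by
  refine CFC.sqrt_unique ?_ ((posDef_transportMatrix hA hB).conj_posDef hA.sqrt).posSemidef.nonneg
  have h3 := CFC.sqrt_mul_sqrt_self _ hA.posSemidef.nonneg
  conv_rhs => rw [← transportMatrix_mul_mul hA hB]
  calc _ = CFC.sqrt A * transportMatrix A B * (CFC.sqrt A * CFC.sqrt A)
        * transportMatrix A B * CFC.sqrt A := by simp only [Matrix.mul_assoc]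
    _ = _ := by rw [h3]; simp only [Matrix.mul_assoc]

lemma trace_sqrt_conj (hA : A.PosDef) (hB : B.PosDef) :
    (CFC.sqrt (CFC.sqrt A * B * CFC.sqrt A)).trace = (transportMatrix A B * A).trace := by
  rw [sqrt_conj_eq hA hB, Matrix.trace_mul_comm, ← Matrix.mul_assoc,
    CFC.sqrt_mul_sqrt_self _ hA.posSemidef.nonneg, Matrix.trace_mul_comm]

lemma trace_transportMatrixInv_mul (hA : A.PosDef) (hB : B.PosDef) :
    (transportMatrixInv A B * B).trace = (transportMatrix A B * A).trace := by
  have h : transportMatrixInv A B * B = A * transportMatrix A B := by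
    calc _ = transportMatrixInv A B * (transportMatrix A B * A * transportMatrix A B) := by
          rw [transportMatrix_mul_mul hA hB]
      _ = _ := by
          rw [← Matrix.mul_assoc, ← Matrix.mul_assoc, transportMatrixInv_mul hA hB, Matrix.one_mul]
  rw [h, Matrix.trace_mul_comm]

lemma det_transportMatrixInv (hA : A.PosDef) (hB : B.PosDef) :
    (transportMatrixInv A B).det = √(A.det / B.det) := by
  have h1 := congrArg Matrix.det (transportMatrix_mul_mul hA hB)
  have h2 := congrArg Matrix.det (transportMatrix_mul_inv hA hB)
  have h3 := (posDef_transportMatrixInv hA hB).det_pos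
  have h4 := hB.det_pos
  rw [Matrix.det_mul, Matrix.det_mul] at h1
  rw [Matrix.det_mul, Matrix.det_one] at h2
  symm
  rw [Real.sqrt_eq_iff_mul_self_eq_of_pos h3, eq_div_iff h4.ne', ← h1]
  -- With m, k the two determinants and a = det A, the goal is (mk)² a = a, and (mk)² a - a = (mk a
  -- + a)(mk - 1).
  linear_combination ((transportMatrix A B).det * (transportMatrixInv A B).det * A.det + A.det) * h2

lemma Matrix.IsHermitian.inner_toEuclideanCLM_left {A : Matrix ι ι ℝ} (hA : A.IsHermitian)
    (x y : EuclideanSpace ℝ ι) :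
    inner ℝ (Matrix.toEuclideanCLM (𝕜 := ℝ) A x) y
      = inner ℝ x (Matrix.toEuclideanCLM (𝕜 := ℝ) A y) := by
  have h : IsSelfAdjoint (Matrix.toEuclideanCLM (𝕜 := ℝ) A) := IsSelfAdjoint.map hA _
  rw [← ContinuousLinearMap.adjoint_inner_right, h.adjoint_eq]

lemma Matrix.toEuclideanCLM_mul_apply (A B : Matrix ι ι ℝ) (x : EuclideanSpace ℝ ι) :
    Matrix.toEuclideanCLM (𝕜 := ℝ) (A * B) x
      = Matrix.toEuclideanCLM (𝕜 := ℝ) A (Matrix.toEuclideanCLM (𝕜 := ℝ) B x) := by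
  rw [map_mul]; rfl

lemma Matrix.toEuclideanCLM_apply_of_mul_eq_one {A B : Matrix ι ι ℝ} (h : A * B = 1)
    (x : EuclideanSpace ℝ ι) :
    Matrix.toEuclideanCLM (𝕜 := ℝ) A (Matrix.toEuclideanCLM (𝕜 := ℝ) B x) = x := by
  rw [← Matrix.toEuclideanCLM_mul_apply, h, map_one]; rfl

/-- A positive definite quadratic form dominates a multiple of the squared norm. -/
lemma Matrix.PosDef.exists_norm_sq_le {A : Matrix ι ι ℝ} (hA : A.PosDef) :
    ∃ C : ℝ, 0 < C ∧ ∀ x : EuclideanSpace ℝ ι,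
      ‖x‖ ^ 2 ≤ C * inner ℝ x (Matrix.toEuclideanCLM (𝕜 := ℝ) A x) := by
  have hS : CFC.sqrt A * CFC.sqrt A = A := CFC.sqrt_mul_sqrt_self _ hA.posSemidef.nonneg
  have hi : (CFC.sqrt A)⁻¹ * CFC.sqrt A = 1 :=
    Matrix.nonsing_inv_mul _ (hA.sqrt.isUnit.map Matrix.detMonoidHom)
  -- The bound comes from x = A^{-1/2} (A^{1/2} x) and ⟨x, A x⟩ = ‖A^{1/2} x‖². The added 1 keeps
  -- the constant positive in dimension 0, where the operator norm vanishes.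
  refine ⟨‖Matrix.toEuclideanCLM (𝕜 := ℝ) (CFC.sqrt A)⁻¹‖ ^ 2 + 1, by positivity, fun x => ?_⟩
  have h1 : inner ℝ x (Matrix.toEuclideanCLM (𝕜 := ℝ) A x)
      = ‖Matrix.toEuclideanCLM (𝕜 := ℝ) (CFC.sqrt A) x‖ ^ 2 := by
    rw [← real_inner_self_eq_norm_sq, hA.sqrt.isHermitian.inner_toEuclideanCLM_left,
      ← Matrix.toEuclideanCLM_mul_apply, hS]
  have h2 := (Matrix.toEuclideanCLM (𝕜 := ℝ) (CFC.sqrt A)⁻¹).le_opNorm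
    (Matrix.toEuclideanCLM (𝕜 := ℝ) (CFC.sqrt A) x)
  rw [Matrix.toEuclideanCLM_apply_of_mul_eq_one hi] at h2
  have h3 := pow_le_pow_left₀ (norm_nonneg x) h2 2
  rw [h1]
  nlinarith [sq_nonneg ‖Matrix.toEuclideanCLM (𝕜 := ℝ) (CFC.sqrt A) x‖]

lemma Matrix.PosSemidef.inner_toEuclideanCLM_nonneg {A : Matrix ι ι ℝ} (hA : A.PosSemidef)
    (x : EuclideanSpace ℝ ι) : 0 ≤ inner ℝ x (Matrix.toEuclideanCLM (𝕜 := ℝ) A x) := by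
  rw [Matrix.inner_toEuclideanCLM]
  simpa using hA.dotProduct_mulVec_nonneg x.ofLp

end Matrix

/-! ### Laws with prescribed mean and covariance. -/

section EuclideanSpace

variable {n : ℕ}

/-- `ν` is a probability measure with finite second moment, mean `μ` and covariance `P`. -/
structure HasMeanCov (ν : Measure (EuclideanSpace ℝ (Fin n))) (μ : EuclideanSpace ℝ (Fin n))
    (P : Matrix (Fin n) (Fin n) ℝ) : Prop where
  prob : IsProbabilityMeasure ν
  memLp : MemLp (fun x => x) 2 ν
  mean : ∫ x, x ∂ν = μ
  cov : ∀ i j, ∫ x, (x i - μ i) * (x j - μ j) ∂ν = P i j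

namespace HasMeanCov

variable {ν : Measure (EuclideanSpace ℝ (Fin n))} {μ : EuclideanSpace ℝ (Fin n)}
  {P : Matrix (Fin n) (Fin n) ℝ}

lemma memLp_affine (h : HasMeanCov ν μ P)
    (L : EuclideanSpace ℝ (Fin n) →L[ℝ] EuclideanSpace ℝ (Fin n))
    (b : EuclideanSpace ℝ (Fin n)) : MemLp (fun x => L x + b) 2 ν := by
  have := h.prob
  exact (L.comp_memLp' h.memLp).add (memLp_const b)

lemma integrable_coord (h : HasMeanCov ν μ P) (i j : Fin n) :
    Integrable (fun x => (x i - μ i) * (x j - μ j)) ν := by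
  have := h.prob
  have hm (k : Fin n) : MemLp (fun x : EuclideanSpace ℝ (Fin n) => x k - μ k) 2 ν :=
    ((EuclideanSpace.proj (𝕜 := ℝ) k).comp_memLp' h.memLp).sub (memLp_const (μ k))
  exact (hm i).integrable_mul (hm j)

/-- The order `x j * x i` makes integration produce P j i, so the double sum becomes tr(A P) with no
appeal to the symmetry of P. -/
lemma inner_eq_sum (A : Matrix (Fin n) (Fin n) ℝ) (x : EuclideanSpace ℝ (Fin n)) :
    inner ℝ x (Matrix.toEuclideanCLM (𝕜 := ℝ) A x) = ∑ i, ∑ j, A i j * (x j * x i) := by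
  rw [Matrix.inner_toEuclideanCLM]
  simp only [dotProduct, Matrix.mulVec, Finset.mul_sum]
  exact Finset.sum_congr rfl fun i _ => Finset.sum_congr rfl fun j _ => by ring

lemma integrable_inner (h : HasMeanCov ν μ P) (A : Matrix (Fin n) (Fin n) ℝ) :
    Integrable (fun x => inner ℝ (x - μ) (Matrix.toEuclideanCLM (𝕜 := ℝ) A (x - μ))) ν := by
  simp only [inner_eq_sum, PiLp.sub_apply]
  exact integrable_finsetSum _ fun i _ => integrable_finsetSum _ fun j _ =>
    (h.integrable_coord j i).const_mul _

lemma integral_inner (h : HasMeanCov ν μ P) (A : Matrix (Fin n) (Fin n) ℝ) :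
    ∫ x, inner ℝ (x - μ) (Matrix.toEuclideanCLM (𝕜 := ℝ) A (x - μ)) ∂ν = (A * P).trace := by
  simp only [inner_eq_sum, PiLp.sub_apply]
  have hi (i j : Fin n) : Integrable (fun x => A i j * ((x j - μ j) * (x i - μ i))) ν :=
    (h.integrable_coord j i).const_mul _
  rw [integral_finsetSum _ fun i _ => integrable_finsetSum _ fun j _ => hi i j]
  simp only [Matrix.trace, Matrix.diag, Matrix.mul_apply]
  refine Finset.sum_congr rfl fun i _ => ?_
  rw [integral_finsetSum _ fun j _ => hi i j]
  refine Finset.sum_congr rfl fun j _ => ?_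
  rw [← h.cov, ← integral_const_mul]

lemma integrable_id (h : HasMeanCov ν μ P) : Integrable (fun x => x) ν := by
  have := h.prob
  exact h.memLp.integrable (by norm_num)

lemma map_affine (h : HasMeanCov ν μ P) (A : Matrix (Fin n) (Fin n) ℝ)
    (b : EuclideanSpace ℝ (Fin n)) :
    HasMeanCov (ν.map fun x => Matrix.toEuclideanCLM (𝕜 := ℝ) A x + b)
      (Matrix.toEuclideanCLM (𝕜 := ℝ) A μ + b) (A * P * Aᵀ) := by
  have := h.prob
  have hT : Measurable fun x => Matrix.toEuclideanCLM (𝕜 := ℝ) A x + b := by fun_prop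
  refine ⟨Measure.isProbabilityMeasure_map hT.aemeasurable, ?_, ?_, fun i j => ?_⟩
  · rw [memLp_map_measure_iff (by fun_prop) hT.aemeasurable]
    exact h.memLp_affine _ b
  · rw [integral_map hT.aemeasurable (by fun_prop),
      integral_add (((Matrix.toEuclideanCLM (𝕜 := ℝ) A).integrable_comp h.integrable_id))
        (integrable_const b), ContinuousLinearMap.integral_comp_comm _ h.integrable_id, h.mean]
    simp
  · rw [integral_map hT.aemeasurable (by fun_prop)]
    -- The outer sum over l and inner sum over k match the expansion of (A P) Aᵀ.
    have key (x : EuclideanSpace ℝ (Fin n)) :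
        ((Matrix.toEuclideanCLM (𝕜 := ℝ) A x + b) i - (Matrix.toEuclideanCLM (𝕜 := ℝ) A μ + b) i) *
        ((Matrix.toEuclideanCLM (𝕜 := ℝ) A x + b) j - (Matrix.toEuclideanCLM (𝕜 := ℝ) A μ + b) j)
        = ∑ l, ∑ k, A i k * A j l * ((x k - μ k) * (x l - μ l)) := by
      have hc (i : Fin n) : (Matrix.toEuclideanCLM (𝕜 := ℝ) A x + b) i
          - (Matrix.toEuclideanCLM (𝕜 := ℝ) A μ + b) i = ∑ k, A i k * (x k - μ k) := by
        simp [Matrix.mulVec, dotProduct, mul_sub]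
      rw [hc, hc, Finset.sum_mul_sum, Finset.sum_comm]
      exact Finset.sum_congr rfl fun l _ => Finset.sum_congr rfl fun k _ => by ring
    simp only [key]
    rw [integral_finsetSum _ fun l _ => integrable_finsetSum _ fun k _ =>
      (h.integrable_coord k l).const_mul _, Matrix.mul_apply]
    refine Finset.sum_congr rfl fun l _ => ?_
    rw [integral_finsetSum _ fun k _ => (h.integrable_coord k l).const_mul _,
      Matrix.mul_apply, Finset.sum_mul]
    refine Finset.sum_congr rfl fun k _ => ?_
    rw [integral_const_mul, h.cov, Matrix.transpose_apply]
    ring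

end HasMeanCov

/-! ### From densities to the measures they define. -/

section Density

variable {ρ : EuclideanSpace ℝ (Fin n) → ℝ}

lemma integral_pdfMeasure {E : Type*} [NormedAddCommGroup E] [NormedSpace ℝ E]
    (h0 : ∀ x, 0 ≤ ρ x) (hm : AEMeasurable ρ) (f : EuclideanSpace ℝ (Fin n) → E) :
    ∫ x, f x ∂(pdfMeasure ρ) = ∫ x, ρ x • f x := by
  rw [pdfMeasure, integral_withDensity_eq_integral_toReal_smul₀ hm.ennreal_ofReal (by simp)]
  simp [ENNReal.toReal_ofReal (h0 _)]

lemma integrable_pdfMeasure_iff {E : Type*} [NormedAddCommGroup E] [NormedSpace ℝ E]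
    (h0 : ∀ x, 0 ≤ ρ x) (hm : AEMeasurable ρ) {f : EuclideanSpace ℝ (Fin n) → E} :
    Integrable f (pdfMeasure ρ) ↔ Integrable fun x => ρ x • f x := by
  rw [pdfMeasure, integrable_withDensity_iff_integrable_smul₀' hm.ennreal_ofReal (by simp)]
  simp [ENNReal.toReal_ofReal (h0 _)]

lemma isPDF_iff (h0 : ∀ x, 0 ≤ ρ x) (hm : AEMeasurable ρ) :
    IsPDF ρ ↔ IsProbabilityMeasure (pdfMeasure ρ) := by
  have h1 : pdfMeasure ρ Set.univ = ∫⁻ x, ENNReal.ofReal (ρ x) := by simp [pdfMeasure]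
  constructor
  · rintro ⟨-, hi, h⟩
    refine ⟨?_⟩
    rw [h1, ← ofReal_integral_eq_lintegral_ofReal hi (ae_of_all _ h0), h, ENNReal.ofReal_one]
  · intro h
    have h2 := integrable_const (μ := pdfMeasure ρ) (1 : ℝ)
    have h3 := integral_pdfMeasure h0 hm (fun _ => (1 : ℝ))
    rw [integrable_pdfMeasure_iff h0 hm] at h2
    exact ⟨h0, by simpa using h2, by simpa using h3.symm⟩

/-- The bridge that lets the transport argument be carried out for measures alone; the reverse
direction certifies that the candidate density is admissible. -/
lemma mem_pdfsWith_iff (h0 : ∀ x, 0 ≤ ρ x) (hm : AEMeasurable ρ)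
    {μ : EuclideanSpace ℝ (Fin n)} {P : Matrix (Fin n) (Fin n) ℝ} :
    ρ ∈ pdfsWith μ P ↔ HasMeanCov (pdfMeasure ρ) μ P := by
  have hsq : Integrable (fun x => ‖x‖ ^ 2 * ρ x) ↔ MemLp (fun x => x) 2 (pdfMeasure ρ) := by
    rw [memLp_two_iff_integrable_sq_norm (by fun_prop), integrable_pdfMeasure_iff h0 hm]
    simp [mul_comm]
  have hmean (h : IsProbabilityMeasure (pdfMeasure ρ)) (h2 : MemLp (fun x => x) 2 (pdfMeasure ρ)) :
      pdfMean ρ = ∫ x, x ∂(pdfMeasure ρ) := by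
    ext i
    have := (EuclideanSpace.proj (𝕜 := ℝ) i).integral_comp_comm (h2.integrable (by norm_num))
    simp only [EuclideanSpace.coe_proj] at this
    rw [← this, integral_pdfMeasure h0 hm]
    simp [pdfMean, mul_comm]
  have hcov (μ : EuclideanSpace ℝ (Fin n)) (i j : Fin n) :
      ∫ x, (x i - μ i) * (x j - μ j) ∂(pdfMeasure ρ)
        = ∫ x, (x i - μ i) * (x j - μ j) * ρ x := by
    rw [integral_pdfMeasure h0 hm]
    simp [mul_comm]
  constructor
  · rintro ⟨⟨hp, h2⟩, h3, h4⟩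
    rw [isPDF_iff h0 hm] at hp
    rw [hsq] at h2
    refine ⟨hp, h2, (hmean hp h2).symm.trans h3, fun i j => ?_⟩
    rw [hcov, ← h4, ← h3]
    rfl
  · rintro ⟨hp, h2, h3, h4⟩
    have h5 := (hmean hp h2).trans h3
    refine ⟨⟨(isPDF_iff h0 hm).2 hp, hsq.2 h2⟩, h5, ?_⟩
    ext i j
    rw [← h4, hcov, ← h5]
    rfl

lemma hasMeanCov_of_mem_pdfsWith {μ : EuclideanSpace ℝ (Fin n)} {P : Matrix (Fin n) (Fin n) ℝ}
    (h : ρ ∈ pdfsWith μ P) : HasMeanCov (pdfMeasure ρ) μ P :=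
  (mem_pdfsWith_iff h.1.1.1 h.1.1.2.1.aestronglyMeasurable.aemeasurable).1 h

end Density

/-! ### Characteristic functions: L¹ stability and affine images. -/

section CharFun

lemma norm_exp_mul_I_sub_exp_mul_I_le (a b : ℝ) :
    ‖Complex.exp (a * Complex.I) - Complex.exp (b * Complex.I)‖ ≤ |a - b| := by
  have h : Complex.exp (a * Complex.I) - Complex.exp (b * Complex.I)
      = Complex.exp (b * Complex.I) * (Complex.exp (Complex.I * ((a - b : ℝ) : ℂ)) - 1) := by
    rw [mul_sub, ← Complex.exp_add, mul_one]
    push_cast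
    ring_nf
  rw [h, norm_mul, Complex.norm_exp_ofReal_mul_I, one_mul]
  exact Real.norm_exp_I_mul_ofReal_sub_one_le

/-- Because s ↦ exp(i s) is 1-Lipschitz, L¹ closeness of two random vectors forces closeness of
their characteristic functions. Uniqueness of the minimizer rests on this estimate. -/
lemma norm_charFun_map_sub_charFun_map_le {Ω E : Type*} [MeasurableSpace Ω]
    [NormedAddCommGroup E] [InnerProductSpace ℝ E] [MeasurableSpace E] [BorelSpace E]
    [SecondCountableTopology E]
    {σ : Measure Ω} [IsProbabilityMeasure σ] {X Y : Ω → E} (hX : Measurable X) (hY : Measurable Y)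
    (hi : Integrable (fun ω => ‖X ω - Y ω‖) σ) (t : E) :
    ‖charFun (σ.map X) t - charFun (σ.map Y) t‖ ≤ ‖t‖ * ∫ ω, ‖X ω - Y ω‖ ∂σ := by
  have hint {Z : Ω → E} (hZ : Measurable Z) :
      Integrable (fun ω => Complex.exp ((inner ℝ (Z ω) t : ℝ) * Complex.I)) σ := by
    refine Integrable.of_bound (C := 1) (by fun_prop) (ae_of_all _ fun ω => ?_)
    rw [Complex.norm_exp_ofReal_mul_I]
  rw [charFun_apply, charFun_apply, integral_map hX.aemeasurable (by fun_prop),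
    integral_map hY.aemeasurable (by fun_prop), ← integral_sub (hint hX) (hint hY),
    ← integral_const_mul]
  refine norm_integral_le_of_norm_le (hi.const_mul _) (ae_of_all _ fun ω => ?_)
  refine (norm_exp_mul_I_sub_exp_mul_I_le _ _).trans ?_
  rw [← inner_sub_left, mul_comm]
  exact abs_real_inner_le_norm _ _

lemma charFun_map_affine {ν : Measure (EuclideanSpace ℝ (Fin n))}
    (A : Matrix (Fin n) (Fin n) ℝ) (b t : EuclideanSpace ℝ (Fin n)) :
    charFun (ν.map fun x => Matrix.toEuclideanCLM (𝕜 := ℝ) A x + b) t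
      = charFun ν (Matrix.toEuclideanCLM (𝕜 := ℝ) Aᵀ t)
        * Complex.exp ((inner ℝ b t : ℝ) * Complex.I) := by
  have h : Matrix.toEuclideanCLM (𝕜 := ℝ) Aᵀ
      = ContinuousLinearMap.adjoint (Matrix.toEuclideanCLM (𝕜 := ℝ) A) := by
    rw [← Matrix.conjTranspose_eq_transpose_of_trivial, ← Matrix.star_eq_conjTranspose, map_star]
    rfl
  rw [charFun_apply, charFun_apply, integral_map (by fun_prop) (by fun_prop),
    ← integral_mul_const]
  congr 1
  ext x
  rw [← Complex.exp_add, h, ContinuousLinearMap.adjoint_inner_right, inner_add_left]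
  push_cast
  ring_nf

lemma map_affine_multivariateGaussian (μ b : EuclideanSpace ℝ (Fin n))
    (A S : Matrix (Fin n) (Fin n) ℝ) (hS : S.PosSemidef) :
    (multivariateGaussian μ S).map (fun x => Matrix.toEuclideanCLM (𝕜 := ℝ) A x + b)
      = multivariateGaussian (Matrix.toEuclideanCLM (𝕜 := ℝ) A μ + b) (A * S * Aᵀ) := by
  have hS' : (A * S * Aᵀ).PosSemidef := by
    simpa using hS.mul_mul_conjTranspose_same A
  have : IsProbabilityMeasure ((multivariateGaussian μ S).map
      (fun x => Matrix.toEuclideanCLM (𝕜 := ℝ) A x + b)) :=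
    Measure.isProbabilityMeasure_map (by fun_prop)
  refine Measure.ext_of_charFun ?_
  ext t
  have h1 : inner ℝ (Matrix.toEuclideanCLM (𝕜 := ℝ) Aᵀ t) μ
      = inner ℝ t (Matrix.toEuclideanCLM (𝕜 := ℝ) A μ) := by
    rw [real_inner_comm, Matrix.inner_toEuclideanCLM, Matrix.inner_toEuclideanCLM,
      Matrix.mulVec_transpose, dotProduct_comm, Matrix.dotProduct_mulVec]
  have h2 : (Aᵀ *ᵥ t.ofLp) ⬝ᵥ S *ᵥ (Aᵀ *ᵥ t.ofLp) = t.ofLp ⬝ᵥ (A * S * Aᵀ) *ᵥ t.ofLp := by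
    simp only [← Matrix.mulVec_mulVec, Matrix.mulVec_transpose, Matrix.dotProduct_mulVec]
  rw [charFun_map_affine, charFun_multivariateGaussian hS, charFun_multivariateGaussian hS',
    ← Complex.exp_add, h1, Matrix.ofLp_toEuclideanCLM, h2, inner_add_right, real_inner_comm t b]
  push_cast
  ring_nf

end CharFun

/-! ### Change of variables under affine bijections. -/

section Affine

lemma LinearMap.det_toEuclideanCLM (A : Matrix (Fin n) (Fin n) ℝ) :
    LinearMap.det (Matrix.toEuclideanCLM (𝕜 := ℝ) A :
      EuclideanSpace ℝ (Fin n) →ₗ[ℝ] EuclideanSpace ℝ (Fin n)) = A.det := by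
  rw [Matrix.coe_toEuclideanCLM_eq_toEuclideanLin, Matrix.toEuclideanLin,
    Matrix.toLpLin_eq_toLin, LinearMap.det_toLin]

lemma map_affine_volume {A : Matrix (Fin n) (Fin n) ℝ} (hA : A.det ≠ 0)
    (b : EuclideanSpace ℝ (Fin n)) :
    (volume : Measure (EuclideanSpace ℝ (Fin n))).map
      (fun x => Matrix.toEuclideanCLM (𝕜 := ℝ) A x + b) = ENNReal.ofReal |A.det⁻¹| • volume := by
  have h := Measure.map_linearMap_addHaar_eq_smul_addHaar
    (volume : Measure (EuclideanSpace ℝ (Fin n)))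
    (f := (Matrix.toEuclideanCLM (𝕜 := ℝ) A : EuclideanSpace ℝ (Fin n) →ₗ[ℝ] _))
    (by rwa [LinearMap.det_toEuclideanCLM])
  rw [LinearMap.det_toEuclideanCLM] at h
  have h2 : (fun x => Matrix.toEuclideanCLM (𝕜 := ℝ) A x + b)
    = (fun x => x + b) ∘ (Matrix.toEuclideanCLM (𝕜 := ℝ) A) := rfl
  rw [h2, ← Measure.map_map (by fun_prop) (by fun_prop)]
  erw [h]
  rw [Measure.map_smul, map_add_right_eq_self]

/-- The affine bijection with linear parts `A` and `B = A⁻¹` sending `a` to `b`. -/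
noncomputable def affineMeasurableEquiv {A B : Matrix (Fin n) (Fin n) ℝ} (h : A * B = 1)
    (a b : EuclideanSpace ℝ (Fin n)) :
    EuclideanSpace ℝ (Fin n) ≃ᵐ EuclideanSpace ℝ (Fin n) where
  toFun x := Matrix.toEuclideanCLM (𝕜 := ℝ) A (x - a) + b
  invFun x := Matrix.toEuclideanCLM (𝕜 := ℝ) B (x - b) + a
  left_inv x := by simp [Matrix.toEuclideanCLM_apply_of_mul_eq_one (mul_eq_one_comm.mp h)]
  right_inv x := by simp [Matrix.toEuclideanCLM_apply_of_mul_eq_one h]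
  measurable_toFun := by dsimp; fun_prop
  measurable_invFun := by dsimp; fun_prop

variable {A B : Matrix (Fin n) (Fin n) ℝ}

lemma affine_sub_eq (A : Matrix (Fin n) (Fin n) ℝ) (a b : EuclideanSpace ℝ (Fin n)) :
    (fun x => Matrix.toEuclideanCLM (𝕜 := ℝ) A (x - a) + b)
      = fun x => Matrix.toEuclideanCLM (𝕜 := ℝ) A x + (b - Matrix.toEuclideanCLM (𝕜 := ℝ) A a) := by
  ext1 x
  rw [map_sub]
  abel

/-- Change of variables with Jacobian |det A|⁻¹ = det B. No measurability of `ρ` is needed, since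
the map is a measurable equivalence and the factor is a finite constant. -/
lemma map_pdfMeasure_affine (h : A * B = 1) (hB : 0 < B.det) (a b : EuclideanSpace ℝ (Fin n))
    (ρ : EuclideanSpace ℝ (Fin n) → ℝ) :
    (pdfMeasure ρ).map (fun x => Matrix.toEuclideanCLM (𝕜 := ℝ) A (x - a) + b)
      = pdfMeasure fun x => B.det * ρ (Matrix.toEuclideanCLM (𝕜 := ℝ) B (x - b) + a) := by
  have hdet : A.det * B.det = 1 := by rw [← Matrix.det_mul, h, Matrix.det_one]
  have hA : A.det⁻¹ = B.det := (eq_inv_of_mul_eq_one_right hdet).symm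
  have hvol : (volume : Measure (EuclideanSpace ℝ (Fin n))).map (affineMeasurableEquiv h a b)
      = ENNReal.ofReal B.det • volume := by
    have := map_affine_volume (left_ne_zero_of_mul_eq_one hdet)
      (b - Matrix.toEuclideanCLM (𝕜 := ℝ) A a)
    rw [← affine_sub_eq, hA, abs_of_pos hB] at this
    exact this
  change (pdfMeasure ρ).map (affineMeasurableEquiv h a b) = pdfMeasure fun x =>
    B.det * ρ ((affineMeasurableEquiv h a b).symm x)
  ext s hs
  rw [MeasurableEquiv.map_apply, pdfMeasure, pdfMeasure,
    withDensity_apply _ ((affineMeasurableEquiv h a b).measurable hs), withDensity_apply _ hs]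
  simp_rw [ENNReal.ofReal_mul hB.le]
  rw [lintegral_const_mul' _ _ ENNReal.ofReal_ne_top, ← smul_eq_mul, ← lintegral_smul_measure,
    ← Measure.restrict_smul, ← hvol, MeasurableEquiv.restrict_map, lintegral_map_equiv]
  simp

/-- Almost-everywhere measurability survives composition because a nonsingular affine map pulls null
sets back to null sets. -/
lemma aemeasurable_comp_affine (hB : B.det ≠ 0) (a b : EuclideanSpace ℝ (Fin n))
    {ρ : EuclideanSpace ℝ (Fin n) → ℝ} (hρ : AEMeasurable ρ) :
    AEMeasurable fun x => ρ (Matrix.toEuclideanCLM (𝕜 := ℝ) B (x - a) + b) := by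
  refine hρ.comp_quasiMeasurePreserving
    (f := fun x => Matrix.toEuclideanCLM (𝕜 := ℝ) B (x - a) + b) ⟨by fun_prop, ?_⟩
  rw [affine_sub_eq, map_affine_volume hB]
  exact Measure.smul_absolutelyContinuous

end Affine

/-! ### The optimal map, the cost decomposition and uniqueness. -/

section Transport

/-- The optimal transport map from a law of mean `μ₀`, covariance `P₀` to mean `μ`,
covariance `P`. -/
noncomputable def transportMap (μ₀ μ : EuclideanSpace ℝ (Fin n)) (P₀ P : Matrix (Fin n) (Fin n) ℝ)
    (y : EuclideanSpace ℝ (Fin n)) : EuclideanSpace ℝ (Fin n) :=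
  Matrix.toEuclideanCLM (𝕜 := ℝ) (transportMatrix P₀ P) (y - μ₀) + μ

/-- The optimal transport cost. -/
noncomputable def transportCost (μ₀ μ : EuclideanSpace ℝ (Fin n))
    (P₀ P : Matrix (Fin n) (Fin n) ℝ) : ℝ :=
  ‖μ - μ₀‖ ^ 2 + (P + P₀ - 2 • CFC.sqrt (CFC.sqrt P₀ * P * CFC.sqrt P₀)).trace

/-- The excess over the optimal cost of moving mass from `z.2` to `z.1`. -/
noncomputable def transportDefect (μ₀ μ : EuclideanSpace ℝ (Fin n))
    (P₀ P : Matrix (Fin n) (Fin n) ℝ)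
    (z : EuclideanSpace ℝ (Fin n) × EuclideanSpace ℝ (Fin n)) : ℝ :=
  inner ℝ (z.1 - transportMap μ₀ μ P₀ P z.2) (Matrix.toEuclideanCLM (𝕜 := ℝ)
    (transportMatrixInv P₀ P) (z.1 - transportMap μ₀ μ P₀ P z.2))

variable {μ₀ μ : EuclideanSpace ℝ (Fin n)} {P₀ P : Matrix (Fin n) (Fin n) ℝ}

lemma continuous_transportMap : Continuous (transportMap μ₀ μ P₀ P) := by
  unfold transportMap
  fun_prop

/-- Completing the square: M⁻¹M = 1 and the symmetry of M⁻¹ reduce the mixed terms to -2⟨x - μ, y -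
μ₀⟩. The squared norms are written as quadratic forms of the matrix 1 so that
`HasMeanCov.integral_inner` evaluates them too. -/
lemma transportDefect_eq (hP₀ : P₀.PosDef) (hP : P.PosDef)
    (x y : EuclideanSpace ℝ (Fin n)) :
    transportDefect μ₀ μ P₀ P (x, y) = ‖x - y‖ ^ 2 - ‖μ - μ₀‖ ^ 2
      - inner ℝ (x - μ) (Matrix.toEuclideanCLM (𝕜 := ℝ) 1 (x - μ))
      - inner ℝ (y - μ₀) (Matrix.toEuclideanCLM (𝕜 := ℝ) 1 (y - μ₀))
      + inner ℝ (x - μ) (Matrix.toEuclideanCLM (𝕜 := ℝ) (transportMatrixInv P₀ P) (x - μ))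
      + inner ℝ (y - μ₀) (Matrix.toEuclideanCLM (𝕜 := ℝ) (transportMatrix P₀ P) (y - μ₀))
      - 2 * inner ℝ (x - y - (μ - μ₀)) (μ - μ₀) := by
  have h1 : x - transportMap μ₀ μ P₀ P y
      = (x - μ) - Matrix.toEuclideanCLM (𝕜 := ℝ) (transportMatrix P₀ P) (y - μ₀) := by
    rw [transportMap]; abel
  have h2 : x - y = (x - μ) - (y - μ₀) + (μ - μ₀) := by abel
  have h3 := Matrix.toEuclideanCLM_apply_of_mul_eq_one (transportMatrixInv_mul hP₀ hP) (y - μ₀)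
  have h4 := (posDef_transportMatrixInv hP₀ hP).isHermitian.inner_toEuclideanCLM_left
    (Matrix.toEuclideanCLM (𝕜 := ℝ) (transportMatrix P₀ P) (y - μ₀)) (x - μ)
  rw [h3] at h4
  simp only [transportDefect, h1, h2, map_one, one_apply_eq_self]
  clear h1 h2
  generalize x - μ = a at *
  generalize y - μ₀ = b at *
  generalize μ - μ₀ = d at *
  simp only [map_sub, h3, add_sub_cancel_right, inner_sub_left, inner_sub_right, ← h4, norm_add_sq_real,
    norm_sub_sq_real, real_inner_self_eq_norm_sq]
  rw [real_inner_comm a b, real_inner_comm b (Matrix.toEuclideanCLM (𝕜 := ℝ) _ b)]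
  ring

lemma transportDefect_nonneg (hP₀ : P₀.PosDef) (hP : P.PosDef)
    (z : EuclideanSpace ℝ (Fin n) × EuclideanSpace ℝ (Fin n)) :
    0 ≤ transportDefect μ₀ μ P₀ P z :=
  (posDef_transportMatrixInv hP₀ hP).posSemidef.inner_toEuclideanCLM_nonneg _

variable {ν ν₀ : Measure (EuclideanSpace ℝ (Fin n))}
  {σ : Measure (EuclideanSpace ℝ (Fin n) × EuclideanSpace ℝ (Fin n))}

lemma integrable_cost (hν : HasMeanCov ν μ P) (hν₀ : HasMeanCov ν₀ μ₀ P₀)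
    (hσ : σ ∈ couplings ν ν₀) : Integrable (fun z => ‖z.1 - z.2‖ ^ 2) σ := by
  obtain ⟨hp, -, rfl, rfl⟩ := hσ
  have h1 : MemLp (fun z => z.1) 2 σ :=
    hν.memLp.comp_of_map (by fun_prop)
  have h2 : MemLp (fun z => z.2) 2 σ :=
    hν₀.memLp.comp_of_map (by fun_prop)
  exact (memLp_two_iff_integrable_sq_norm (by fun_prop)).1 (h1.sub h2)

/-- In `transportDefect_eq` only ‖x - y‖² couples the variables. The quadratic forms integrate to
traces against the marginals, and the linear term has mean zero. -/
lemma integral_transportDefect (hP₀ : P₀.PosDef) (hP : P.PosDef)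
    (hν : HasMeanCov ν μ P) (hν₀ : HasMeanCov ν₀ μ₀ P₀) (hσ : σ ∈ couplings ν ν₀) :
    Integrable (transportDefect μ₀ μ P₀ P) σ ∧
    ∫ z, ‖z.1 - z.2‖ ^ 2 ∂σ
      = transportCost μ₀ μ P₀ P + ∫ z, transportDefect μ₀ μ P₀ P z ∂σ := by
  have hc := integrable_cost hν hν₀ hσ
  obtain ⟨hp, -, h1, h2⟩ := hσ
  have hf {E : Type} [NormedAddCommGroup E] [NormedSpace ℝ E] {f : EuclideanSpace ℝ (Fin n) → E}
      (hf : Continuous f) (hi : Integrable f ν) :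
      Integrable (fun z => f z.1) σ ∧ ∫ z, f z.1 ∂σ = ∫ x, f x ∂ν := by
    subst h1
    exact ⟨(integrable_map_measure hi.1 (by fun_prop)).1 hi,
      (integral_map (by fun_prop) hi.1).symm⟩
  have hs {E : Type} [NormedAddCommGroup E] [NormedSpace ℝ E] {f : EuclideanSpace ℝ (Fin n) → E}
      (hf : Continuous f) (hi : Integrable f ν₀) :
      Integrable (fun z => f z.2) σ ∧ ∫ z, f z.2 ∂σ = ∫ x, f x ∂ν₀ := by
    subst h2
    exact ⟨(integrable_map_measure hi.1 (by fun_prop)).1 hi,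
      (integral_map (by fun_prop) hi.1).symm⟩
  obtain ⟨i1, e1⟩ := hf (by fun_prop) (hν.integrable_inner 1)
  obtain ⟨i2, e2⟩ := hs (by fun_prop) (hν₀.integrable_inner 1)
  obtain ⟨i3, e3⟩ := hf (by fun_prop) (hν.integrable_inner (transportMatrixInv P₀ P))
  obtain ⟨i4, e4⟩ := hs (by fun_prop) (hν₀.integrable_inner (transportMatrix P₀ P))
  obtain ⟨i5, e5⟩ := hf (by fun_prop) hν.integrable_id
  obtain ⟨i6, e6⟩ := hs (by fun_prop) hν₀.integrable_id
  have i7 : Integrable (fun z => z.1 - z.2 - (μ - μ₀)) σ :=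
    (i5.sub i6).sub (integrable_const _)
  have e7 : ∫ z, (z.1 - z.2 - (μ - μ₀)) ∂σ = 0 := by
    rw [integral_sub (i5.sub' i6) (integrable_const _), integral_sub i5 i6, e5, e6, hν.mean,
      hν₀.mean]
    simp
  have i8 : Integrable (fun z => inner ℝ (z.1 - z.2 - (μ - μ₀)) (μ - μ₀)) σ :=
    i7.inner_const _
  have e8 : ∫ z, inner ℝ (z.1 - z.2 - (μ - μ₀)) (μ - μ₀) ∂σ = 0 := by
    simp_rw [real_inner_comm (μ - μ₀)]
    rw [integral_inner i7, e7, inner_zero_right]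
  have hd : transportDefect μ₀ μ P₀ P = fun z => _ :=
    funext fun z => transportDefect_eq hP₀ hP z.1 z.2
  have j1 := hc.sub (integrable_const (‖μ - μ₀‖ ^ 2))
  have j2 := j1.sub i1
  have j3 := j2.sub i2
  have j4 := j3.add i3
  have j5 := j4.add i4
  have j6 := j5.sub (i8.const_mul 2)
  have htr : transportCost μ₀ μ P₀ P = ‖μ - μ₀‖ ^ 2 + P.trace + P₀.trace
      - 2 * (transportMatrix P₀ P * P₀).trace := by
    rw [transportCost, Matrix.trace_sub, Matrix.trace_add, Matrix.trace_smul,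
      trace_sqrt_conj hP₀ hP, nsmul_eq_mul]
    push_cast
    ring
  rw [hd]
  refine ⟨j6, ?_⟩
  have key := integral_sub' j5 (i8.const_mul 2)
  rw [integral_add' j4 i4, integral_add' j3 i3, integral_sub' j2 i2, integral_sub' j1 i1,
    integral_sub' hc (integrable_const _), integral_const_mul, e1, e2, e3, e4, e8,
    hν.integral_inner, hν.integral_inner, hν₀.integral_inner, hν₀.integral_inner,
    trace_transportMatrixInv_mul hP₀ hP] at key
  simp only [integral_const, probReal_univ, one_smul,
    Matrix.one_mul] at key
  have hsum := key.symm
  simp only [Pi.sub_def, Pi.add_def] at hsum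
  rw [← hsum, htr]
  ring

lemma lintegral_cost (hP₀ : P₀.PosDef) (hP : P.PosDef)
    (hν : HasMeanCov ν μ P) (hν₀ : HasMeanCov ν₀ μ₀ P₀) (hσ : σ ∈ couplings ν ν₀) :
    ∫⁻ z, ENNReal.ofReal (‖z.1 - z.2‖ ^ 2) ∂σ
      = ENNReal.ofReal (transportCost μ₀ μ P₀ P + ∫ z, transportDefect μ₀ μ P₀ P z ∂σ) := by
  rw [← ofReal_integral_eq_lintegral_ofReal (integrable_cost hν hν₀ hσ)
    (ae_of_all _ fun z => sq_nonneg _), (integral_transportDefect hP₀ hP hν hν₀ hσ).2]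

lemma hasMeanCov_map_transportMap (hP₀ : P₀.PosDef) (hP : P.PosDef)
    (hν₀ : HasMeanCov ν₀ μ₀ P₀) : HasMeanCov (ν₀.map (transportMap μ₀ μ P₀ P)) μ P := by
  have h := hν₀.map_affine (transportMatrix P₀ P)
    (μ - Matrix.toEuclideanCLM (𝕜 := ℝ) (transportMatrix P₀ P) μ₀)
  have hT : (transportMatrix P₀ P)ᵀ = transportMatrix P₀ P :=
    (posDef_transportMatrix hP₀ hP).isHermitian
  rwa [hT, transportMatrix_mul_mul hP₀ hP, add_sub_cancel, ← affine_sub_eq] at h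

lemma map_transportMap_mem_couplings (hP₀ : P₀.PosDef) (hP : P.PosDef)
    (hν₀ : HasMeanCov ν₀ μ₀ P₀) :
    ν₀.map (fun y => (transportMap μ₀ μ P₀ P y, y))
      ∈ couplings (ν₀.map (transportMap μ₀ μ P₀ P)) ν₀ := by
  have := hν₀.prob
  have hT := (continuous_transportMap (μ₀ := μ₀) (μ := μ) (P₀ := P₀) (P := P)).measurable
  have hT' : Measurable fun y => (transportMap μ₀ μ P₀ P y, y) := hT.prodMk measurable_id
  have h1 : MemLp (transportMap μ₀ μ P₀ P) 2 ν₀ :=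
    (memLp_map_measure_iff (by fun_prop) hT.aemeasurable).1
      (hasMeanCov_map_transportMap hP₀ hP hν₀).memLp
  refine ⟨Measure.isProbabilityMeasure_map hT'.aemeasurable, ?_, ?_, ?_⟩
  · rw [lintegral_map (by fun_prop) hT']
    exact ((h1.integrable_norm_pow (by norm_num)).add
      (hν₀.memLp.integrable_norm_pow (by norm_num))).lintegral_lt_top
  · rw [Measure.map_map measurable_fst hT']
    rfl
  · rw [Measure.map_map measurable_snd hT']
    exact Measure.map_id

lemma lintegral_cost_transportMap (hP₀ : P₀.PosDef) (hP : P.PosDef)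
    (hν₀ : HasMeanCov ν₀ μ₀ P₀) :
    ∫⁻ z, ENNReal.ofReal (‖z.1 - z.2‖ ^ 2) ∂(ν₀.map fun y => (transportMap μ₀ μ P₀ P y, y))
      = ENNReal.ofReal (transportCost μ₀ μ P₀ P) ∧ 0 ≤ transportCost μ₀ μ P₀ P := by
  have hσ := map_transportMap_mem_couplings (μ := μ) hP₀ hP hν₀
  have hν := hasMeanCov_map_transportMap (μ := μ) hP₀ hP hν₀
  have hT := (continuous_transportMap (μ₀ := μ₀) (μ := μ) (P₀ := P₀) (P := P)).measurable
  have hT' : Measurable fun y => (transportMap μ₀ μ P₀ P y, y) := hT.prodMk measurable_id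
  obtain ⟨hi, he⟩ := integral_transportDefect hP₀ hP hν hν₀ hσ
  have h0 : ∫ z, transportDefect μ₀ μ P₀ P z
      ∂(ν₀.map fun y => (transportMap μ₀ μ P₀ P y, y)) = 0 := by
    -- The defect vanishes identically on the graph of the transport map.
    rw [integral_map hT'.aemeasurable hi.1]
    simp [transportDefect]
  refine ⟨by rw [lintegral_cost hP₀ hP hν hν₀ hσ, h0, add_zero], ?_⟩
  rw [h0, add_zero] at he
  rw [← he]
  exact integral_nonneg fun z => sq_nonneg _

lemma sq_measureW₂ (ν₁ ν₂ : Measure (EuclideanSpace ℝ (Fin n))) :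
    measureW₂ ν₁ ν₂ ^ 2 = ⨅ σ ∈ couplings ν₁ ν₂, ∫⁻ z, ENNReal.ofReal (‖z.1 - z.2‖ ^ 2) ∂σ := by
  rw [measureW₂, ← ENNReal.rpow_natCast, ← ENNReal.rpow_mul]
  norm_num

lemma transportCost_le_sq_measureW₂ (hP₀ : P₀.PosDef) (hP : P.PosDef)
    (hν : HasMeanCov ν μ P) (hν₀ : HasMeanCov ν₀ μ₀ P₀) :
    ENNReal.ofReal (transportCost μ₀ μ P₀ P) ≤ measureW₂ ν ν₀ ^ 2 := by
  rw [sq_measureW₂]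
  refine le_iInf₂ fun σ hσ => ?_
  rw [lintegral_cost hP₀ hP hν hν₀ hσ]
  exact ENNReal.ofReal_le_ofReal
    (le_add_of_nonneg_right (integral_nonneg (transportDefect_nonneg hP₀ hP)))

lemma sq_measureW₂_map_transportMap (hP₀ : P₀.PosDef) (hP : P.PosDef)
    (hν₀ : HasMeanCov ν₀ μ₀ P₀) :
    measureW₂ (ν₀.map (transportMap μ₀ μ P₀ P)) ν₀ ^ 2
      = ENNReal.ofReal (transportCost μ₀ μ P₀ P) := by
  refine le_antisymm ?_ (transportCost_le_sq_measureW₂ hP₀ hP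
    (hasMeanCov_map_transportMap hP₀ hP hν₀) hν₀)
  rw [sq_measureW₂, ← (lintegral_cost_transportMap hP₀ hP hν₀).1]
  exact iInf₂_le _ (map_transportMap_mem_couplings hP₀ hP hν₀)

/-- The minimizer of the transport cost is unique. -/
lemma eq_map_transportMap (hP₀ : P₀.PosDef) (hP : P.PosDef)
    (hν : HasMeanCov ν μ P) (hν₀ : HasMeanCov ν₀ μ₀ P₀)
    (h : measureW₂ ν ν₀ ^ 2 = ENNReal.ofReal (transportCost μ₀ μ P₀ P)) :
    ν = ν₀.map (transportMap μ₀ μ P₀ P) := by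
  have hT := (continuous_transportMap (μ₀ := μ₀) (μ := μ) (P₀ := P₀) (P := P)).measurable
  have := hν.prob
  have := (hasMeanCov_map_transportMap (μ := μ) hP₀ hP hν₀).prob
  obtain ⟨C, hC, hle⟩ := (posDef_transportMatrixInv hP₀ hP).exists_norm_sq_le
  refine Measure.ext_of_charFun (funext fun t => ?_)
  rw [← sub_eq_zero, ← norm_le_zero_iff]
  -- A nearly optimal coupling, with total defect below δ², replaces an optimal one.
  have key (δ : ℝ) (hδ : 0 < δ) :
      ‖charFun ν t - charFun (ν₀.map (transportMap μ₀ μ P₀ P)) t‖ ≤ ‖t‖ * (1 + C) * δ := by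
    have hlt : measureW₂ ν ν₀ ^ 2 < ENNReal.ofReal (transportCost μ₀ μ P₀ P + δ ^ 2) := by
      rw [h, ENNReal.ofReal_lt_ofReal_iff_of_nonneg (lintegral_cost_transportMap hP₀ hP hν₀).2]
      exact lt_add_of_pos_right _ (by positivity)
    rw [sq_measureW₂] at hlt
    simp only [iInf_lt_iff] at hlt
    obtain ⟨σ, hσ, hlt⟩ := hlt
    rw [lintegral_cost hP₀ hP hν hν₀ hσ] at hlt
    have hlt := (ENNReal.ofReal_lt_ofReal_iff'.1 hlt).1
    obtain ⟨hi, -⟩ := integral_transportDefect hP₀ hP hν hν₀ hσ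
    have hb (z : EuclideanSpace ℝ (Fin n) × EuclideanSpace ℝ (Fin n)) :
        ‖z.1 - transportMap μ₀ μ P₀ P z.2‖ ≤ δ + C / δ * transportDefect μ₀ μ P₀ P z := by
      have h1 := hle (z.1 - transportMap μ₀ μ P₀ P z.2)
      -- The inequality r ≤ δ + r²/δ turns the quadratic defect into an L¹ bound: a defect below δ²,
      -- weighted by C/δ, contributes at most C δ, which gives (1 + C) δ in total.
      have h2 : ‖z.1 - transportMap μ₀ μ P₀ P z.2‖
          ≤ δ + ‖z.1 - transportMap μ₀ μ P₀ P z.2‖ ^ 2 / δ := by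
        rw [← sub_le_iff_le_add', le_div_iff₀ hδ]
        nlinarith [sq_nonneg (‖z.1 - transportMap μ₀ μ P₀ P z.2‖ - δ),
          norm_nonneg (z.1 - transportMap μ₀ μ P₀ P z.2)]
      refine h2.trans (add_le_add_right ?_ _)
      rw [div_mul_eq_mul_div]
      exact div_le_div_of_nonneg_right h1 hδ.le
    obtain ⟨hp, -, h1, h2⟩ := hσ
    have hi2 : Integrable (fun z => δ + C / δ * transportDefect μ₀ μ P₀ P z) σ :=
      (integrable_const δ).add (hi.const_mul _)
    have hi3 : Integrable (fun z => ‖z.1 - transportMap μ₀ μ P₀ P z.2‖) σ := by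
      refine hi2.mono' ?_ (ae_of_all _ fun z => by simpa using hb z)
      exact (measurable_fst.sub (hT.comp measurable_snd)).norm.aestronglyMeasurable
    have h3 := norm_charFun_map_sub_charFun_map_le measurable_fst (hT.comp measurable_snd) hi3 t
    rw [← Measure.map_map hT measurable_snd, h1, h2] at h3
    refine h3.trans ?_
    rw [mul_assoc]
    refine mul_le_mul_of_nonneg_left ?_ (norm_nonneg t)
    refine (integral_mono hi3 hi2 hb).trans ?_
    rw [integral_add (integrable_const δ) (hi.const_mul _), integral_const_mul]
    simp only [integral_const, probReal_univ, one_smul]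
    have h4 : C / δ * ∫ z, transportDefect μ₀ μ P₀ P z ∂σ ≤ C / δ * δ ^ 2 :=
      mul_le_mul_of_nonneg_left (by linarith) (by positivity)
    have h5 : C / δ * δ ^ 2 = C * δ := by field_simp
    linarith
  -- The added 1 keeps the divisor positive when t = 0.
  have hpos : 0 < ‖t‖ * (1 + C) + 1 := by positivity
  refine le_of_forall_pos_le_add fun ε hε => ?_
  have h6 := key (ε / (‖t‖ * (1 + C) + 1)) (by positivity)
  refine h6.trans ?_
  rw [zero_add, mul_div_assoc', div_le_iff₀ hpos]
  nlinarith

end Transport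

/-! ### Explicit Gaussian densities. -/

section Gaussian

variable {P₀ P : Matrix (Fin n) (Fin n) ℝ}

/-- Obtained by inverting M P₀ M = P. It turns the exponent of the Gaussian with covariance P₀ into
that of the one with covariance P. -/
lemma transportMatrixInv_mul_inv_mul (hP₀ : P₀.PosDef) (hP : P.PosDef) :
    transportMatrixInv P₀ P * P₀⁻¹ * transportMatrixInv P₀ P = P⁻¹ := by
  have h : (transportMatrix P₀ P)⁻¹ = transportMatrixInv P₀ P :=
    Matrix.inv_eq_right_inv (transportMatrix_mul_inv hP₀ hP)
  rw [← transportMatrix_mul_mul hP₀ hP, Matrix.mul_inv_rev, Matrix.mul_inv_rev,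
    transportMatrix_mul_mul hP₀ hP, h, Matrix.mul_assoc]

lemma gaussianDensity_comp_affine (hP₀ : P₀.PosDef) (hP : P.PosDef)
    (μ₀ μ x : EuclideanSpace ℝ (Fin n)) :
    √(P₀.det / P.det) * gaussianDensity μ₀ P₀
      (Matrix.toEuclideanCLM (𝕜 := ℝ) (transportMatrixInv P₀ P) (x - μ) + μ₀)
      = gaussianDensity μ P x := by
  have hc : √(P₀.det / P.det) * (√((2 * Real.pi) ^ n * P₀.det))⁻¹
      = (√((2 * Real.pi) ^ n * P.det))⁻¹ := by
    have h0 := hP₀.det_pos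
    have h1 := hP.det_pos
    rw [← Real.sqrt_inv, ← Real.sqrt_inv, ← Real.sqrt_mul (by positivity)]
    congr 1
    field_simp
  rw [gaussianDensity, gaussianDensity, ← mul_assoc, hc, add_sub_cancel_right,
    (posDef_transportMatrixInv hP₀ hP).isHermitian.inner_toEuclideanCLM_left,
    ← Matrix.toEuclideanCLM_mul_apply, ← Matrix.toEuclideanCLM_mul_apply,
    transportMatrixInv_mul_inv_mul hP₀ hP]

end Gaussian

end EuclideanSpace

/-- Square roots of positive semidefinite matrices are `CFC.sqrt`. The infimum is over densities
with mean `μ` and covariance `P`; densities are identified when equal almost everywhere. -/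
theorem lemma2 (n : ℕ) (μ₀ μ : EuclideanSpace ℝ (Fin n))
    (P₀ P : Matrix (Fin n) (Fin n) ℝ) (hP₀ : P₀.PosDef) (hP : P.PosDef)
    (ρ₀ : EuclideanSpace ℝ (Fin n) → ℝ) (hρ₀ : ρ₀ ∈ pdfsWith μ₀ P₀)
    (M : Matrix (Fin n) (Fin n) ℝ)
    (hM : M = CFC.sqrt P * (CFC.sqrt (CFC.sqrt P * P₀ * CFC.sqrt P))⁻¹ * CFC.sqrt P)
    (m : EuclideanSpace ℝ (Fin n))
    (hm : m = μ - Matrix.toEuclideanCLM (𝕜 := ℝ) M μ₀)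
    (ρ : EuclideanSpace ℝ (Fin n) → ℝ)
    (hρ : ρ = fun x => Real.sqrt (P₀.det / P.det) *
      ρ₀ (Matrix.toEuclideanCLM (𝕜 := ℝ)
        ((CFC.sqrt P)⁻¹ * CFC.sqrt (CFC.sqrt P * P₀ * CFC.sqrt P) * (CFC.sqrt P)⁻¹)
        (x - μ) + μ₀)) :
    -- the value of the infimum, a finite number
    (infSqW₂ μ P ρ₀ ≠ ∞ ∧
      (infSqW₂ μ P ρ₀).toReal = ‖μ - μ₀‖ ^ 2 +
        (P + P₀ - 2 • CFC.sqrt (CFC.sqrt P₀ * P * CFC.sqrt P₀)).trace) ∧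
    -- it is attained at `ρ`, which is the density of the push-forward of `ρ₀` under `M x + m`
    (ρ ∈ pdfsWith μ P ∧
      pdfMeasure ρ = (pdfMeasure ρ₀).map
        (fun x => Matrix.toEuclideanCLM (𝕜 := ℝ) M x + m) ∧
      W₂ ρ ρ₀ ^ 2 = infSqW₂ μ P ρ₀) ∧
    -- it is attained only there
    (∀ η ∈ pdfsWith μ P, W₂ η ρ₀ ^ 2 = infSqW₂ μ P ρ₀ →
      η =ᵐ[volume] ρ) ∧
    -- the Gaussian case, for the explicit densities and for the laws
    ((ρ₀ = gaussianDensity μ₀ P₀ → ρ = gaussianDensity μ P) ∧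
      (pdfMeasure ρ₀ = multivariateGaussian μ₀ P₀ →
        pdfMeasure ρ = multivariateGaussian μ P)) := by
  replace hM : M = transportMatrix P₀ P := hM
  replace hρ : ρ = fun x => √(P₀.det / P.det) *
    ρ₀ (Matrix.toEuclideanCLM (𝕜 := ℝ) (transportMatrixInv P₀ P) (x - μ) + μ₀) := hρ
  have hν₀ := hasMeanCov_of_mem_pdfsWith hρ₀
  have hdet := det_transportMatrixInv hP₀ hP
  have hpos := (posDef_transportMatrixInv hP₀ hP).det_pos
  have hT : (fun x => Matrix.toEuclideanCLM (𝕜 := ℝ) M x + m) = transportMap μ₀ μ P₀ P := by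
    rw [hm, hM, ← affine_sub_eq]
    rfl
  have hmap : pdfMeasure ρ = (pdfMeasure ρ₀).map (transportMap μ₀ μ P₀ P) := by
    rw [hρ, ← hdet]
    exact (map_pdfMeasure_affine (transportMatrix_mul_inv hP₀ hP) hpos μ₀ μ ρ₀).symm
  have hρ_nonneg : ∀ x, 0 ≤ ρ x := fun x => by
    rw [hρ]
    exact mul_nonneg (Real.sqrt_nonneg _) (hρ₀.1.1.1 _)
  have hρ_meas : AEMeasurable ρ := by
    rw [hρ]
    exact (aemeasurable_comp_affine hpos.ne' μ μ₀
      hρ₀.1.1.2.1.aestronglyMeasurable.aemeasurable).const_mul _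
  have hρ_mem : ρ ∈ pdfsWith μ P := by
    rw [mem_pdfsWith_iff hρ_nonneg hρ_meas, hmap]
    exact hasMeanCov_map_transportMap hP₀ hP hν₀
  have hρ_cost : W₂ ρ ρ₀ ^ 2 = ENNReal.ofReal (transportCost μ₀ μ P₀ P) := by
    rw [W₂, hmap, sq_measureW₂_map_transportMap hP₀ hP hν₀]
  have hinf : infSqW₂ μ P ρ₀ = ENNReal.ofReal (transportCost μ₀ μ P₀ P) :=
    le_antisymm (hρ_cost ▸ iInf₂_le ρ hρ_mem) (le_iInf₂ fun ξ hξ =>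
      transportCost_le_sq_measureW₂ hP₀ hP (hasMeanCov_of_mem_pdfsWith hξ) hν₀)
  refine ⟨⟨hinf ▸ ENNReal.ofReal_ne_top, ?_⟩, ⟨hρ_mem, hT ▸ hmap, hρ_cost.trans hinf.symm⟩,
    fun η hη h => ?_, fun h => ?_, fun h => ?_⟩
  · rw [hinf, ENNReal.toReal_ofReal (lintegral_cost_transportMap hP₀ hP hν₀).2]
    rfl
  · have hην := hasMeanCov_of_mem_pdfsWith hη
    have heq : pdfMeasure η = pdfMeasure ρ := by
      rw [hmap]
      exact eq_map_transportMap hP₀ hP hην hν₀ (h.trans hinf)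
    have hη_meas := hη.1.1.2.1.aestronglyMeasurable.aemeasurable
    -- Equal measures have almost everywhere equal extended densities, and nonnegativity allows
    -- `ENNReal.ofReal` to be removed.
    have hae := (withDensity_eq_iff_of_sigmaFinite hη_meas.ennreal_ofReal
      hρ_meas.ennreal_ofReal).1 heq
    filter_upwards [hae] with x hx
    exact (ENNReal.ofReal_eq_ofReal_iff (hη.1.1.1 x) (hρ_nonneg x)).1 hx
  · ext x
    rw [hρ, h]
    exact gaussianDensity_comp_affine hP₀ hP μ₀ μ x
  · have hMT : Mᵀ = M := hM ▸ (posDef_transportMatrix hP₀ hP).isHermitian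
    rw [hmap, h, ← hT, map_affine_multivariateGaussian _ _ _ _ hP₀.posSemidef, hMT, hM,
      transportMatrix_mul_mul hP₀ hP, hm, hM, add_sub_cancel]
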